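/- Let $S \subseteq \mathbb{N}^r$ be an affine semigroup minimally generated by $\mathcal{A} = \{\mathbf{a}_1,\ldots,\mathbf{a}_p\}$, and let $A$ be the $r\times p$ matrix with columns $\mathbf{a}_1,\ldots,\mathbf{a}_p$. Let $\pi_{\mathcal A}:\mathbb{N}^p\to S$, $\mathbf u\mapsto A\mathbf u$, let $\equiv_{\mathcal A}$ be its kernel congruence, and let $\mathsf Z(\mathbf b)=\pi_{\mathcal A}^{-1}(\mathbf b)$ be the set of factorizations of $\mathbf b \in S$. A presentation of $S$ is a set $\sigma\subseteq\mathbb{N}^p\times\mathbb{N}^p$ that generates $\equiv_{\mathcal A}$ as a congruence; it is minimal if no proper subset of it is a presentation. All minimal presentations have the same cardinality $\nu(S)$, and the set $\mathrm{Betti}(S)=\{\pi_{\mathcal A}(\mathbf u)\mid(\mathbf u,\mathbf v)\in\sigma\}$ is the same for every minimal presentation $\sigma$. The set $\mathcal C_{\mathcal A}$ of circuits consists of the nonzero pairs $(\mathbf u,\mathbf v)\in\mathbb{N}^p\times\mathbb{N}^p$ with $\pi_{\mathcal A}(\mathbf u)=\pi_{\mathcal A}(\mathbf v)$ and $\mathrm{supp}(\mathbf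 u)\cap\mathrm{supp}(\mathbf v)=\varnothing$ such that $\mathrm{supp}(\mathbf u)\cup\mathrm{supp}(\mathbf v)$ is minimal with respect to inclusion among all such pairs, and such that the coordinates of $(\mathbf u,\mathbf v)$ have greatest common divisor $1$. A semigroup $S$ with minimal generating set $\mathcal A$ is the gluing of $S_1$ and $S_2$ by a nonzero $\mathbf d\in S_1\cap S_2$ if $\mathcal A$ is the disjoint union of nonempty subsets $\mathcal A_1$, $\mathcal A_2$ generating $S_1$, $S_2$, respectively, with $\mathbb{Z}\mathcal A_1\cap\mathbb{Z}\mathcal A_2=\mathbb{Z}\mathbf d$ in $\mathbb{Z}^r$. Recursively, $S$ is the gluing of $S_1,\ldots,S_n$ by $\mathbf d$ if either $n=1$ and $S=S_1$, or $n\ge 2$ and $S$ is the gluing by $\mathbf d$ of $S_1$ and some $T$ that is the gluing of $S_2,\ldots,S_n$ by $\mathbf d$. A semigroup is free if it is isomorphic, as a monoid, to $\mathbb{N}^s$ for some $s$. Let $\mathbf d\in S$ be nonzero. If $\mathrm{Betti}(S)=\{\mathbf d\}$, then: (a) $\mathcal C_{\mathcal A}$ is a presentation of $S$; (b) $\mathsf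 Z(\mathbf d)$ is finite and $S$ is the gluing by $\mathbf d$ of $\#\mathsf Z(\mathbf d)$ free affine semigroups; (c) $S$ is a complete intersection, that is, $\nu(S)=p-\mathrm{rank}(A)$. -/

import Mathlib

namespace AffineSemigroup

/-- `𝒜` is a finite generating set of the submonoid `S` of `ℕ^r`, and no proper subset of `𝒜`
generates `S`. -/
structure IsMinGenSet {r : ℕ} (𝒜 : Set (Fin r → ℕ)) (S : AddSubmonoid (Fin r → ℕ)) : Prop where
  finite : 𝒜.Finite
  closure_eq : AddSubmonoid.closure 𝒜 = S
  minimal : ∀ ℬ : Set (Fin r → ℕ), ℬ ⊂ 𝒜 → AddSubmonoid.closure ℬ ≠ S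

/-- `S` is minimally generated by `{a₁, …, a_p}` (with `a₁, …, a_p` pairwise distinct). -/
structure IsMinGenBy {r p : ℕ} (a : Fin p → Fin r → ℕ) (S : AddSubmonoid (Fin r → ℕ)) : Prop where
  injective : Function.Injective a
  isMinGenSet : IsMinGenSet (Set.range a) S

/-- The `r × p` matrix with columns `a₁, …, a_p`, with entries seen in `ℚ`. -/
def genMatrix {r p : ℕ} (a : Fin p → Fin r → ℕ) : Matrix (Fin r) (Fin p) ℚ :=
  Matrix.of fun i j => (a j i : ℚ)

/-- The factorization homomorphism `ℕ^p → ℕ^r`, `u ↦ ∑ i, u_i a_i`. -/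
def factHom {r p : ℕ} (a : Fin p → Fin r → ℕ) : (Fin p → ℕ) →+ (Fin r → ℕ) where
  toFun u := ∑ i, u i • a i
  map_zero' := by simp
  map_add' u v := by simp [add_smul, Finset.sum_add_distrib]

/-- The set of factorizations of `b`. -/
def factorizations {r p : ℕ} (a : Fin p → Fin r → ℕ) (b : Fin r → ℕ) : Set (Fin p → ℕ) :=
  {u | factHom a u = b}

/-- `σ` is a presentation: the congruence generated by `σ` is the kernel congruence of the
factorization homomorphism. -/
def IsPresentation {r p : ℕ} (a : Fin p → Fin r → ℕ)
    (σ : Set ((Fin p → ℕ) × (Fin p → ℕ))) : Prop :=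
  addConGen (fun u v => (u, v) ∈ σ) = AddCon.ker (factHom a)

/-- A presentation none of whose proper subsets is a presentation. -/
def IsMinPresentation {r p : ℕ} (a : Fin p → Fin r → ℕ)
    (σ : Set ((Fin p → ℕ) × (Fin p → ℕ))) : Prop :=
  IsPresentation a σ ∧ ∀ τ : Set ((Fin p → ℕ) × (Fin p → ℕ)), τ ⊂ σ → ¬ IsPresentation a τ

/-- The Betti elements: the elements `π(u)` for the pairs `(u, v)` in a minimal presentation. -/
def betti {r p : ℕ} (a : Fin p → Fin r → ℕ) : Set (Fin r → ℕ) :=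
  {b | ∃ σ : Set ((Fin p → ℕ) × (Fin p → ℕ)), IsMinPresentation a σ ∧
    ∃ w ∈ σ, factHom a w.1 = b}

/-- Minimal presentations exist, and every one of them has exactly `n` elements. -/
def IsNu {r p : ℕ} (a : Fin p → Fin r → ℕ) (n : ℕ) : Prop :=
  (∃ σ : Set ((Fin p → ℕ) × (Fin p → ℕ)), IsMinPresentation a σ) ∧
    ∀ σ : Set ((Fin p → ℕ) × (Fin p → ℕ)), IsMinPresentation a σ → σ.encard = n

/-- The number of elements of a minimal presentation equals `p - rank A`. -/
def IsCompleteIntersection {r p : ℕ} (a : Fin p → Fin r → ℕ) : Prop :=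
  ∃ n : ℕ, IsNu a n ∧ n + (genMatrix a).rank = p

/-- The nonzero elements `(u, v)` of the kernel congruence with `supp u` and `supp v` disjoint. -/
def disjointRelations {r p : ℕ} (a : Fin p → Fin r → ℕ) : Set ((Fin p → ℕ) × (Fin p → ℕ)) :=
  {w | w ≠ 0 ∧ factHom a w.1 = factHom a w.2 ∧
    Disjoint (Function.support w.1) (Function.support w.2)}

/-- The circuits: the pairs `(u, v)` in `disjointRelations a` such that `supp u ∪ supp v` is
minimal with respect to inclusion among all pairs in `disjointRelations a`, and such that the
coordinates of `u` and `v` have greatest common divisor `1`. -/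
def circuits {r p : ℕ} (a : Fin p → Fin r → ℕ) : Set ((Fin p → ℕ) × (Fin p → ℕ)) :=
  {w | w ∈ disjointRelations a ∧
    (∀ w' ∈ disjointRelations a,
      ¬ (Function.support w'.1 ∪ Function.support w'.2 ⊂
          Function.support w.1 ∪ Function.support w.2)) ∧
    Nat.gcd (Finset.univ.gcd w.1) (Finset.univ.gcd w.2) = 1}

/-- The inclusion of `ℕ^r` in `ℤ^r`. -/
def toInt {r : ℕ} (x : Fin r → ℕ) : Fin r → ℤ := fun i => (x i : ℤ)

/-- `S` is the gluing of `S₁` and `S₂` by `d`: the minimal generating set of `S` is the disjoint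
union of two nonempty sets generating `S₁` and `S₂`, and `d` is a nonzero element of `S₁ ∩ S₂`
such that `ℤ𝒜₁ ∩ ℤ𝒜₂ = ℤd`. -/
def IsGluing {r : ℕ} (d : Fin r → ℕ) (S S₁ S₂ : AddSubmonoid (Fin r → ℕ)) : Prop :=
  ∃ 𝒜₁ 𝒜₂ : Set (Fin r → ℕ), 𝒜₁.Nonempty ∧ 𝒜₂.Nonempty ∧ Disjoint 𝒜₁ 𝒜₂ ∧
    IsMinGenSet (𝒜₁ ∪ 𝒜₂) S ∧
    AddSubmonoid.closure 𝒜₁ = S₁ ∧ AddSubmonoid.closure 𝒜₂ = S₂ ∧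
    d ∈ S₁ ∧ d ∈ S₂ ∧ d ≠ 0 ∧
    AddSubgroup.closure (toInt '' 𝒜₁) ⊓ AddSubgroup.closure (toInt '' 𝒜₂) =
      AddSubgroup.zmultiples (toInt d)

/-- `S` is the gluing by `d` of the semigroups `S₁, …, S_n` in a list, defined recursively:
`S` is the gluing of the one-term list `[S]`, and `S` is the gluing of `S₁, S₂, …, S_n` if it is
the gluing of `S₁` and some `T`, where `T` is the gluing of `S₂, …, S_n`. -/
inductive IsIteratedGluing {r : ℕ} (d : Fin r → ℕ) :
    AddSubmonoid (Fin r → ℕ) → List (AddSubmonoid (Fin r → ℕ)) → Prop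
  | single (S : AddSubmonoid (Fin r → ℕ)) : IsIteratedGluing d S [S]
  | glue (S S₁ T : AddSubmonoid (Fin r → ℕ)) (L : List (AddSubmonoid (Fin r → ℕ))) :
      IsGluing d S S₁ T → IsIteratedGluing d T L → IsIteratedGluing d S (S₁ :: L)

/-- `S` is isomorphic to `ℕ^s` for some `s`. -/
def IsFree {r : ℕ} (S : AddSubmonoid (Fin r → ℕ)) : Prop :=
  ∃ s : ℕ, Nonempty (S ≃+ (Fin s → ℕ))

end AffineSemigroup

namespace AffineSemigroup

variable {r p : ℕ} {a : Fin p → Fin r → ℕ} {σ τ : Set ((Fin p → ℕ) × (Fin p → ℕ))}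
  {d : Fin r → ℕ}

/-! Every defining relation lives in degree `d`, so two distinct factorizations of one element each
dominate a factorization of `d` (`exists_le_of_ne`). Elements not above `d` thus factor uniquely.
Two factorizations of `d` sharing a generator can cancel it, so they coincide: distinct
factorizations of `d` have disjoint supports. Everything rests on this. (a) Two distinct
factorizations of `d` form a circuit (`mem_circuits`), so a minimal presentation consists of
circuits. (b) Cut the generators along these supports, adding the unused ones to one block. A block
carrying a single factorization of `d` has no nontrivial relation, hence is free; restricting
relations to a block modulo `ℤd` shows that blocks meet in `ℤd` (`zspan_inf_zspan`). (c) Differences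
of the pairs span the rational kernel of the matrix, and a subset whose differences still span is
already a presentation (`of_span_difference`). In a minimal presentation they therefore form a
basis, and rank-nullity concludes. -/

theorem factHom_apply (a : Fin p → Fin r → ℕ) (u : Fin p → ℕ) :
    factHom a u = ∑ i, u i • a i := rfl

theorem factHom_single (a : Fin p → Fin r → ℕ) (i : Fin p) :
    factHom a (Pi.single i 1) = a i := by
  rw [factHom_apply, Finset.sum_eq_single i]
  · simp
  · intro j _ hj
    simp [hj]
  · simp

theorem factHom_mono (a : Fin p → Fin r → ℕ) : Monotone (factHom a) := by
  intro u v h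
  rw [← add_tsub_cancel_of_le h, map_add]
  exact le_self_add

theorem mrange_factHom (a : Fin p → Fin r → ℕ) :
    AddMonoidHom.mrange (factHom a) = AddSubmonoid.closure (Set.range a) := by
  apply le_antisymm
  · rintro _ ⟨u, rfl⟩
    rw [factHom_apply]
    exact sum_mem fun i _ => nsmul_mem (AddSubmonoid.subset_closure (Set.mem_range_self i)) _
  · rw [AddSubmonoid.closure_le]
    rintro _ ⟨i, rfl⟩
    exact AddMonoidHom.mem_mrange.2 ⟨_, factHom_single a i⟩

theorem factHom_mem_closure_image (a : Fin p → Fin r → ℕ) {P : Set (Fin p)} {u : Fin p → ℕ}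
    (hu : Function.support u ⊆ P) : factHom a u ∈ AddSubmonoid.closure (a '' P) := by
  rw [factHom_apply]
  refine sum_mem fun i _ => ?_
  by_cases hi : u i = 0
  · simp [hi]
  · exact nsmul_mem (AddSubmonoid.subset_closure (Set.mem_image_of_mem a (hu hi))) _

theorem factHom_comp {s : ℕ} {g : Fin s → Fin p} (hg : Function.Injective g)
    (a : Fin p → Fin r → ℕ) (x : Fin s → ℕ) :
    factHom (a ∘ g) x = factHom a (Function.extend g x 0) := by
  rw [factHom_apply, factHom_apply]
  refine Fintype.sum_of_injective g hg _ _ ?_ ?_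
  · intro i hi
    rw [Function.extend_apply' _ _ _ (by simpa using hi)]
    simp
  · intro i
    simp [hg.extend_apply]

/-! ### Inclusion in integral and rational vectors -/

theorem toInt_zero : toInt (0 : Fin r → ℕ) = 0 := by
  funext i
  simp [toInt]

theorem toInt_add (x y : Fin r → ℕ) : toInt (x + y) = toInt x + toInt y := by
  funext i
  simp [toInt]

theorem toInt_injective : Function.Injective (toInt (r := r)) := fun x y hxy =>
  funext fun i => by simpa [toInt] using congrFun hxy i

theorem toInt_mem_zspan {𝒜 : Set (Fin r → ℕ)} {x : Fin r → ℕ}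
    (hx : x ∈ AddSubmonoid.closure 𝒜) : toInt x ∈ AddSubgroup.closure (toInt '' 𝒜) := by
  induction hx using AddSubmonoid.closure_induction with
  | mem x hx => exact AddSubgroup.subset_closure ⟨x, hx, rfl⟩
  | zero => exact toInt_zero (r := r) ▸ zero_mem _
  | add x y _ _ hx hy => exact toInt_add x y ▸ add_mem hx hy

theorem exists_sub_of_mem_zspan {P : Set (Fin p)} {z : Fin r → ℤ}
    (hz : z ∈ AddSubgroup.closure (toInt '' (a '' P))) :
    ∃ s t : Fin p → ℕ, Function.support s ⊆ P ∧ Function.support t ⊆ P ∧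
      z = toInt (factHom a s) - toInt (factHom a t) := by
  induction hz using AddSubgroup.closure_induction with
  | mem z hz =>
    obtain ⟨_, ⟨i, hi, rfl⟩, rfl⟩ := hz
    refine ⟨Pi.single i 1, 0, ?_, by simp, ?_⟩
    · intro j hj
      by_cases hji : j = i
      · exact hji ▸ hi
      · simp [hji] at hj
    · rw [factHom_single, map_zero, toInt_zero, sub_zero]
  | zero => exact ⟨0, 0, by simp, by simp, by simp⟩
  | add x y _ _ hx hy =>
    obtain ⟨s, t, hs, ht, rfl⟩ := hx
    obtain ⟨s', t', hs', ht', rfl⟩ := hy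
    refine ⟨s + s', t + t', (Function.support_add _ _).trans (Set.union_subset hs hs'),
      (Function.support_add _ _).trans (Set.union_subset ht ht'), ?_⟩
    rw [map_add, map_add, toInt_add, toInt_add]
    abel
  | neg x _ hx =>
    obtain ⟨s, t, hs, ht, rfl⟩ := hx
    exact ⟨t, s, ht, hs, by abel⟩

/-- The inclusion of `ℕ^p` in `ℚ^p`. -/
def castHom : (Fin p → ℕ) →+ (Fin p → ℚ) where
  toFun u i := u i
  map_zero' := by
    funext i
    simp
  map_add' u v := by
    funext i
    simp

/-- The difference of a pair, as a rational vector. -/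
def difference (w : (Fin p → ℕ) × (Fin p → ℕ)) : Fin p → ℚ := castHom w.1 - castHom w.2

theorem genMatrix_mulVec_castHom (a : Fin p → Fin r → ℕ) (u : Fin p → ℕ) :
    (genMatrix a).mulVecLin (castHom u) = castHom (factHom a u) := by
  funext j
  simp [genMatrix, castHom, factHom_apply, Matrix.mulVec, dotProduct, mul_comm]

theorem castHom_injective : Function.Injective (castHom (p := p)) := fun x y hxy =>
  funext fun i => by simpa [castHom] using congrFun hxy i

theorem difference_mem_ker (w : (Fin p → ℕ) × (Fin p → ℕ)) :
    difference w ∈ LinearMap.ker (genMatrix a).mulVecLin ↔ factHom a w.1 = factHom a w.2 := by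
  rw [LinearMap.mem_ker, difference, map_sub, genMatrix_mulVec_castHom, genMatrix_mulVec_castHom,
    sub_eq_zero, castHom_injective.eq_iff]

/-! ### Presentations -/

/-- Induction principle for relations: each later use designs a congruence `C` that encodes the
property wanted and checks it on `σ` only. -/
theorem IsPresentation.rel_of_factHom_eq (h : IsPresentation a σ) (C : AddCon (Fin p → ℕ))
    (hC : ∀ w ∈ σ, C w.1 w.2) {x y : Fin p → ℕ} (hxy : factHom a x = factHom a y) : C x y := by
  have h1 : addConGen (fun u v => (u, v) ∈ σ) ≤ C := AddCon.addConGen_le.2 fun u v huv => hC _ huv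
  rw [h] at h1
  exact h1 ((AddCon.ker_rel _).2 hxy)

theorem IsPresentation.factHom_eq (h : IsPresentation a σ) {w : (Fin p → ℕ) × (Fin p → ℕ)}
    (hw : w ∈ σ) : factHom a w.1 = factHom a w.2 := by
  have h1 : addConGen (fun u v => (u, v) ∈ σ) w.1 w.2 := AddConGen.Rel.of _ _ hw
  rw [h] at h1
  exact (AddCon.ker_rel _).1 h1

theorem IsPresentation.of_rel (h : IsPresentation a σ)
    (hτ : ∀ w ∈ τ, factHom a w.1 = factHom a w.2)
    (hσ : ∀ w ∈ σ, addConGen (fun u v => (u, v) ∈ τ) w.1 w.2) : IsPresentation a τ := by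
  apply le_antisymm
  · exact AddCon.addConGen_le.2 fun u v huv => (AddCon.ker_rel _).2 (hτ _ huv)
  · rw [← h]
    exact AddCon.addConGen_le.2 fun u v huv => hσ _ huv

theorem IsMinPresentation.fst_ne_snd (h : IsMinPresentation a σ)
    {w : (Fin p → ℕ) × (Fin p → ℕ)} (hw : w ∈ σ) : w.1 ≠ w.2 := by
  intro hne
  refine h.2 (σ \ {w}) ⟨Set.sdiff_subset, fun hs => (hs hw).2 rfl⟩
    (h.1.of_rel (fun w' hw' => h.1.factHom_eq hw'.1) fun w' hw' => ?_)
  by_cases hww : w' = w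
  · rw [hww, hne]
    exact AddCon.refl _ _
  · exact AddConGen.Rel.of _ _ ⟨hw', hww⟩

/-! ### Minimal generating sets -/

theorem IsMinGenBy.ne_zero {S : AddSubmonoid (Fin r → ℕ)} (ha : IsMinGenBy a S) (i : Fin p) :
    a i ≠ 0 := by
  intro h0
  refine ha.isMinGenSet.minimal (Set.range a \ {0})
    ⟨Set.sdiff_subset, fun hs => (hs (Set.mem_range_self i)).2 h0⟩ ?_
  rw [AddSubmonoid.closure_sdiff_singleton_zero, ha.isMinGenSet.closure_eq]

theorem IsMinGenBy.isMinGenSet_image {S : AddSubmonoid (Fin r → ℕ)} (ha : IsMinGenBy a S)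
    (P : Set (Fin p)) : IsMinGenSet (a '' P) (AddSubmonoid.closure (a '' P)) where
  finite := P.toFinite.image a
  closure_eq := rfl
  minimal := by
    intro ℬ hℬ hcl
    obtain ⟨_, ⟨j, hj, rfl⟩, hjℬ⟩ := Set.exists_of_ssubset hℬ
    -- A smaller generating set of the block, completed by the generators outside it, would generate
    -- `S`.
    refine ha.isMinGenSet.minimal (ℬ ∪ a '' Pᶜ) ⟨?_, fun hs => ?_⟩ ?_
    · exact Set.union_subset (hℬ.subset.trans (Set.image_subset_range _ _))
        (Set.image_subset_range _ _)
    · rcases hs (Set.mem_range_self j) with h | ⟨k, hk, hkj⟩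
      · exact hjℬ h
      · exact hk (ha.injective hkj ▸ hj)
    · rw [AddSubmonoid.closure_union, hcl, ← AddSubmonoid.closure_union, ← Set.image_union,
        Set.union_compl_self, Set.image_univ, ha.isMinGenSet.closure_eq]

/-! ### Presentations concentrated in one degree -/

/-- `σ` is a presentation of the semigroup generated by the nonzero vectors `a i`, and all its
pairs consist of factorizations of the nonzero element `d`. -/
structure IsPresentationAt (a : Fin p → Fin r → ℕ) (d : Fin r → ℕ)
    (σ : Set ((Fin p → ℕ) × (Fin p → ℕ))) : Prop where
  isPresentation : IsPresentation a σ
  fst_mem : ∀ w ∈ σ, w.1 ∈ factorizations a d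
  generator_ne_zero : ∀ i, a i ≠ 0
  degree_ne_zero : d ≠ 0

namespace IsPresentationAt

variable (h : IsPresentationAt a d σ)
include h

theorem snd_mem {w : (Fin p → ℕ) × (Fin p → ℕ)} (hw : w ∈ σ) : w.2 ∈ factorizations a d :=
  (h.isPresentation.factHom_eq hw).symm.trans (h.fst_mem w hw)

/-- Two distinct factorizations of the same element dominate factorizations of `d`. -/
theorem exists_le_of_ne {x y : Fin p → ℕ} (hxy : factHom a x = factHom a y) (hne : x ≠ y) :
    ∃ u ∈ factorizations a d, u ≤ x := by
  let D : Set (Fin p → ℕ) := {x | ∃ u ∈ factorizations a d, u ≤ x}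
  have hD : ∀ {x} z, x ∈ D → x + z ∈ D := fun z ⟨u, hu, hux⟩ =>
    ⟨u, hu, hux.trans le_self_add⟩
  have hD' : ∀ {x} z, x ∈ D → z + x ∈ D := fun z hx => add_comm _ z ▸ hD z hx
  -- The Rees congruence of the ideal `D`: it contains `σ`, since both sides of each pair lie in
  -- `D`.
  let C : AddCon (Fin p → ℕ) :=
    { r := fun x y => x = y ∨ (x ∈ D ∧ y ∈ D)
      iseqv :=
        { refl := fun x => Or.inl rfl
          symm := by
            rintro x y (h | h)
            · exact Or.inl h.symm
            · exact Or.inr h.symm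
          trans := by
            rintro x y z (rfl | h) (rfl | h')
            · exact Or.inl rfl
            · exact Or.inr h'
            · exact Or.inr h
            · exact Or.inr ⟨h.1, h'.2⟩ }
      add' := by
        rintro x y z w (rfl | h) (rfl | h')
        · exact Or.inl rfl
        · exact Or.inr ⟨hD' _ h'.1, hD' _ h'.2⟩
        · exact Or.inr ⟨hD _ h.1, hD _ h.2⟩
        · exact Or.inr ⟨hD _ h.1, hD _ h.2⟩ }
  have hC : C x y := h.isPresentation.rel_of_factHom_eq C
    (fun w hw => Or.inr ⟨⟨_, h.fst_mem w hw, le_rfl⟩, ⟨_, h.snd_mem hw, le_rfl⟩⟩) hxy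
  rcases hC with hC | hC
  · exact absurd hC hne
  · exact hC.1

theorem eq_of_not_le {x y : Fin p → ℕ} (hxy : factHom a x = factHom a y)
    (hd : ¬ d ≤ factHom a x) : x = y := by
  by_contra hne
  obtain ⟨u, hu, hux⟩ := h.exists_le_of_ne hxy hne
  exact hd ((show factHom a u = d from hu) ▸ factHom_mono a hux)

theorem support_nonempty {u : Fin p → ℕ} (hu : u ∈ factorizations a d) :
    (Function.support u).Nonempty := by
  rw [Function.support_nonempty_iff]
  rintro rfl
  exact h.degree_ne_zero ((show factHom a 0 = d from hu).symm.trans (map_zero _))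

/-- Removing the common generator leaves two factorizations of an element strictly below `d`, where
factorization is unique. -/
theorem eq_of_mem_support {u v : Fin p → ℕ} (hu : u ∈ factorizations a d)
    (hv : v ∈ factorizations a d) {i : Fin p} (hui : u i ≠ 0) (hvi : v i ≠ 0) : u = v := by
  have key : ∀ {u : Fin p → ℕ}, u i ≠ 0 → u - Pi.single i 1 + Pi.single i 1 = u := by
    intro u hui
    refine tsub_add_cancel_of_le fun j => ?_
    by_cases hj : j = i
    · subst hj
      simpa using Nat.one_le_iff_ne_zero.2 hui
    · simp [hj]
  have hu' := congrArg (factHom a) (key hui)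
  have hv' := congrArg (factHom a) (key hvi)
  rw [map_add, factHom_single, show factHom a u = d from hu] at hu'
  rw [map_add, factHom_single, show factHom a v = d from hv] at hv'
  have hle : ¬ d ≤ factHom a (u - Pi.single i 1) := by
    intro hle
    apply h.generator_ne_zero i
    have h1 := hu'.trans_le hle
    exact le_antisymm (by simpa using h1) zero_le
  have := h.eq_of_not_le (add_right_cancel (hu'.trans hv'.symm)) hle
  rw [← key hui, ← key hvi, this]

theorem disjoint_support {u v : Fin p → ℕ} (hu : u ∈ factorizations a d)
    (hv : v ∈ factorizations a d) (hne : u ≠ v) :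
    Disjoint (Function.support u) (Function.support v) :=
  Set.disjoint_left.2 fun _ hui hvi => hne (h.eq_of_mem_support hu hv hui hvi)

/-- Picking one index in each of the disjoint supports embeds the factorizations of `d` in `Fin p`.
-/
theorem finite_factorizations : (factorizations a d).Finite := by
  choose f hf using fun u : factorizations a d => h.support_nonempty u.2
  refine Set.finite_coe_iff.1 (Finite.of_injective f fun u v huv => Subtype.ext ?_)
  exact h.eq_of_mem_support u.2 v.2 (hf u) (huv ▸ hf v)

/-! ### Circuits -/

/-- A common divisor `k ≥ 2` would give two factorizations of `d / k`, an element not above `d`, so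
they would be equal. -/
theorem gcd_eq_one {u v : Fin p → ℕ} (hu : u ∈ factorizations a d)
    (hv : v ∈ factorizations a d) (hne : u ≠ v) :
    Nat.gcd (Finset.univ.gcd u) (Finset.univ.gcd v) = 1 := by
  set k := Nat.gcd (Finset.univ.gcd u) (Finset.univ.gcd v) with hk
  have hku : ∀ i, k ∣ u i := fun i =>
    (Nat.gcd_dvd_left _ _).trans (Finset.gcd_dvd (Finset.mem_univ i))
  have hkv : ∀ i, k ∣ v i := fun i =>
    (Nat.gcd_dvd_right _ _).trans (Finset.gcd_dvd (Finset.mem_univ i))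
  choose u' hu' using hku
  choose v' hv' using hkv
  have hu2 : u = k • u' := funext fun i => by simpa using hu' i
  have hv2 : v = k • v' := funext fun i => by simpa using hv' i
  have hud : k • factHom a u' = d := by rw [← map_nsmul, ← hu2]; exact hu
  have hvd : k • factHom a v' = d := by rw [← map_nsmul, ← hv2]; exact hv
  have hk0 : k ≠ 0 := by
    rintro h0
    rw [h0, zero_smul] at hud
    exact h.degree_ne_zero hud.symm
  by_contra hk1
  have heq : factHom a u' = factHom a v' := by
    funext j
    have := congrFun (hud.trans hvd.symm) j
    simpa [hk0] using this
  have hle : ¬ d ≤ factHom a u' := by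
    intro hle
    apply h.degree_ne_zero
    have hz : factHom a u' = 0 := by
      funext j
      have h1 : d j ≤ factHom a u' j := hle j
      rw [← hud] at h1
      have h2 : k * factHom a u' j ≤ factHom a u' j := by simpa using h1
      have h3 : 2 ≤ k := by omega
      simp only [Pi.zero_apply]
      nlinarith
    rw [← hud, hz, smul_zero]
  exact hne (by rw [hu2, hv2, h.eq_of_not_le heq hle])

/-- For support minimality, the two sides of a relation with smaller support dominate two distinct
factorizations of `d`. By disjointness of supports these can only be `u` and `v`, so the support was
not smaller. -/
theorem mem_circuits {u v : Fin p → ℕ} (hu : u ∈ factorizations a d)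
    (hv : v ∈ factorizations a d) (hne : u ≠ v) : (u, v) ∈ circuits a := by
  refine ⟨⟨?_, hu.trans hv.symm, h.disjoint_support hu hv hne⟩, ?_, h.gcd_eq_one hu hv hne⟩
  · intro h0
    exact hne ((congrArg Prod.fst h0).trans (congrArg Prod.snd h0).symm)
  · rintro ⟨x, y⟩ ⟨h0, hxy, hdis⟩ hss
    have hxne : x ≠ y := by
      rintro rfl
      apply h0
      have : x = 0 := by simpa using hdis
      simp [this]
    obtain ⟨w, hw, hwx⟩ := h.exists_le_of_ne hxy hxne
    obtain ⟨w', hw', hwy⟩ := h.exists_le_of_ne hxy.symm hxne.symm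
    have hsx : Function.support w ⊆ Function.support x := fun i hi h0 =>
      hi (Nat.le_zero.1 (h0 ▸ hwx i))
    have hsy : Function.support w' ⊆ Function.support y := fun i hi h0 =>
      hi (Nat.le_zero.1 (h0 ▸ hwy i))
    have hww : w ≠ w' := by
      rintro rfl
      obtain ⟨i, hi⟩ := h.support_nonempty hw
      exact Set.disjoint_left.1 hdis (hsx hi) (hsy hi)
    have huv : ∀ {w}, w ∈ factorizations a d →
        Function.support w ⊆ Function.support x ∪ Function.support y → w = u ∨ w = v := by
      intro w hw hs
      obtain ⟨i, hi⟩ := h.support_nonempty hw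
      rcases hss.subset (hs hi) with h1 | h1
      · exact Or.inl (h.eq_of_mem_support hw hu hi h1)
      · exact Or.inr (h.eq_of_mem_support hw hv hi h1)
    have h1 := hsx.trans (Set.subset_union_left (t := Function.support y))
    have h2 := hsy.trans (Set.subset_union_right (s := Function.support x))
    refine hss.2 ?_
    rcases huv hw h1 with rfl | rfl <;> rcases huv hw' h2 with rfl | rfl
    · exact absurd rfl hww
    · exact Set.union_subset h1 h2
    · exact Set.union_subset h2 h1
    · exact absurd rfl hww

theorem isPresentation_circuits : IsPresentation a (circuits a) := by
  refine h.isPresentation.of_rel (fun w hw => hw.1.2.1) fun w hw => ?_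
  by_cases hne : w.1 = w.2
  · rw [hne]
    exact AddCon.refl _ _
  · exact AddConGen.Rel.of _ _ (h.mem_circuits (h.fst_mem w hw) (h.snd_mem hw) hne)

/-! ### Gluings -/

omit h in
theorem factHom_indicator {P : Set (Fin p)} {u : Fin p → ℕ} (hu : u ∈ factorizations a d)
    (hP : Function.support u ⊆ P ∨ Disjoint (Function.support u) P) :
    factHom a (P.indicator u) = d ∨ factHom a (P.indicator u) = 0 := by
  rcases hP with hP | hP
  · left
    rw [Set.indicator_eq_self.2 hP]
    exact hu
  · right
    rw [Set.indicator_eq_zero.2 hP]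
    exact map_zero _


/-- Restricted to `P`, each factorization of `d` has degree `d` or `0`, hence vanishes modulo `ℤd`;
so both sides of every pair of `σ` agree there. -/
theorem toInt_factHom_indicator_sub_mem {P : Set (Fin p)}
    (hP : ∀ u ∈ factorizations a d,
      Function.support u ⊆ P ∨ Disjoint (Function.support u) P)
    {x y : Fin p → ℕ} (hxy : factHom a x = factHom a y) :
    toInt (factHom a (P.indicator x)) - toInt (factHom a (P.indicator y)) ∈
      AddSubgroup.zmultiples (toInt d) := by
  let f : (Fin p → ℕ) →+ (Fin r → ℤ) :=
    { toFun := fun x => toInt (factHom a (P.indicator x))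
      map_zero' := by
        rw [Set.indicator_zero', map_zero, toInt_zero]
      map_add' := fun x y => by
        rw [Set.indicator_add', map_add, toInt_add] }
  let C : AddCon (Fin p → ℕ) :=
    AddCon.ker ((QuotientAddGroup.mk' (AddSubgroup.zmultiples (toInt d))).comp f)
  have hC : C x y := by
    refine h.isPresentation.rel_of_factHom_eq C (fun w hw => ?_) hxy
    have key : ∀ u ∈ factorizations a d,
        (QuotientAddGroup.mk' (AddSubgroup.zmultiples (toInt d))).comp f u = 0 := by
      intro u hu
      refine (QuotientAddGroup.eq_zero_iff _).2 ?_
      change toInt (factHom a (P.indicator u)) ∈ _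
      rcases factHom_indicator hu (hP u hu) with h1 | h1
      · rw [h1]
        exact AddSubgroup.mem_zmultiples _
      · rw [h1, toInt_zero]
        exact zero_mem _
    exact (AddCon.ker_rel _).2 ((key _ (h.fst_mem w hw)).trans (key _ (h.snd_mem hw)).symm)
  have hC' : QuotientAddGroup.mk' (AddSubgroup.zmultiples (toInt d)) (f x) =
      QuotientAddGroup.mk' (AddSubgroup.zmultiples (toInt d)) (f y) := (AddCon.ker_rel _).1 hC
  rw [← sub_eq_zero, ← map_sub] at hC'
  exact (QuotientAddGroup.eq_zero_iff _).1 hC'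

theorem zspan_inf_zspan {P Q : Set (Fin p)} (hPQ : Disjoint P Q)
    (hP : ∀ u ∈ factorizations a d,
      Function.support u ⊆ P ∨ Disjoint (Function.support u) P)
    (hdP : ∃ u ∈ factorizations a d, Function.support u ⊆ P)
    (hdQ : ∃ u ∈ factorizations a d, Function.support u ⊆ Q) :
    AddSubgroup.closure (toInt '' (a '' P)) ⊓ AddSubgroup.closure (toInt '' (a '' Q)) =
      AddSubgroup.zmultiples (toInt d) := by
  apply le_antisymm
  · rintro z ⟨hzP, hzQ⟩
    obtain ⟨s, t, hs, ht, rfl⟩ := exists_sub_of_mem_zspan hzP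
    obtain ⟨s', t', hs', ht', hst⟩ := exists_sub_of_mem_zspan hzQ
    -- Moving terms across makes an honest relation over `ℕ`, whose restriction to `P` is the pair
    -- `(s, t)`.
    have heq : factHom a (s + t') = factHom a (t + s') := by
      apply toInt_injective
      rw [map_add, map_add, toInt_add, toInt_add]
      linear_combination hst
    have hmem := h.toInt_factHom_indicator_sub_mem hP heq
    have hQP : ∀ {x : Fin p → ℕ}, Function.support x ⊆ Q → P.indicator x = 0 := fun hx =>
      Set.indicator_eq_zero.2 (hPQ.symm.mono_left hx)
    rwa [Set.indicator_add', Set.indicator_add', hQP hs', hQP ht', add_zero, add_zero,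
      Set.indicator_eq_self.2 hs, Set.indicator_eq_self.2 ht] at hmem
  · rw [AddSubgroup.zmultiples_le]
    obtain ⟨u, hu, huP⟩ := hdP
    obtain ⟨v, hv, hvQ⟩ := hdQ
    refine ⟨?_, ?_⟩
    · rw [← show factHom a u = d from hu]
      exact toInt_mem_zspan (factHom_mem_closure_image a huP)
    · rw [← show factHom a v = d from hv]
      exact toInt_mem_zspan (factHom_mem_closure_image a hvQ)

theorem isGluing_image {S : AddSubmonoid (Fin r → ℕ)} (ha : IsMinGenBy a S)
    {P Q : Set (Fin p)} (hPQ : Disjoint P Q)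
    (hP : ∀ u ∈ factorizations a d,
      Function.support u ⊆ P ∨ Disjoint (Function.support u) P)
    (hdP : ∃ u ∈ factorizations a d, Function.support u ⊆ P)
    (hdQ : ∃ u ∈ factorizations a d, Function.support u ⊆ Q) :
    IsGluing d (AddSubmonoid.closure (a '' (P ∪ Q))) (AddSubmonoid.closure (a '' P))
      (AddSubmonoid.closure (a '' Q)) := by
  have hmem : ∀ {P : Set (Fin p)}, (∃ u ∈ factorizations a d, Function.support u ⊆ P) →
      (a '' P).Nonempty ∧ d ∈ AddSubmonoid.closure (a '' P) := by
    rintro P ⟨u, hu, huP⟩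
    refine ⟨((h.support_nonempty hu).mono huP).image a, ?_⟩
    have := factHom_mem_closure_image a huP
    rwa [show factHom a u = d from hu] at this
  refine ⟨a '' P, a '' Q, (hmem hdP).1, (hmem hdQ).1,
    (Set.disjoint_image_iff ha.injective).2 hPQ, ?_, rfl, rfl, (hmem hdP).2, (hmem hdQ).2,
    h.degree_ne_zero, h.zspan_inf_zspan hPQ hP hdP hdQ⟩
  rw [← Set.image_union]
  exact ha.isMinGenSet_image _

/-- A nontrivial relation inside `P`, once its common part is cancelled, would dominate a
factorization of `d` on each side. Both equal `u`, yet the two sides have disjoint supports. -/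
theorem isFree_closure_image {P : Set (Fin p)} {u : Fin p → ℕ}
    (hP : ∀ v ∈ factorizations a d, Function.support v ⊆ P → v = u) :
    IsFree (AddSubmonoid.closure (a '' P)) := by
  classical
  let e := (Fintype.equivFin P).symm
  let g : Fin (Fintype.card P) → Fin p := fun i => e i
  have hg : Function.Injective g := Subtype.val_injective.comp e.injective
  have hgP : Set.range g = P := by
    change Set.range (Subtype.val ∘ e) = P
    rw [EquivLike.range_comp, Subtype.range_coe]
  have hinj : Function.Injective (factHom (a ∘ g)) := by
    intro x y hxy
    rw [factHom_comp hg, factHom_comp hg] at hxy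
    set x' := Function.extend g x 0 with hx'
    set y' := Function.extend g y 0 with hy'
    have hz : ∀ {x : Fin (Fintype.card P) → ℕ} {i}, i ∉ P → Function.extend g x 0 i = 0 := by
      intro x i hi
      rw [← hgP] at hi
      exact Function.extend_apply' _ _ _ (by simpa using hi)
    suffices x' = y' by
      funext i
      have h1 := congrFun this (g i)
      rwa [hx', hy', hg.extend_apply, hg.extend_apply] at h1
    have hx1 : x' - x' ⊓ y' + x' ⊓ y' = x' := tsub_add_cancel_of_le inf_le_left
    have hy1 : y' - x' ⊓ y' + x' ⊓ y' = y' := tsub_add_cancel_of_le inf_le_right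
    have heq : factHom a (x' - x' ⊓ y') = factHom a (y' - x' ⊓ y') := by
      apply add_right_cancel (b := factHom a (x' ⊓ y'))
      rw [← map_add, ← map_add, hx1, hy1, hxy]
    by_contra hne
    have hne' : x' - x' ⊓ y' ≠ y' - x' ⊓ y' := fun h0 => hne (hx1.symm.trans ((congrArg (· + x' ⊓ y') h0).trans hy1))
    obtain ⟨w, hw, hwx⟩ := h.exists_le_of_ne heq hne'
    obtain ⟨w', hw', hwy⟩ := h.exists_le_of_ne heq.symm hne'.symm
    have hwP : Function.support w ⊆ P := by
      intro i hi
      by_contra hiP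
      have h1 := hwx i
      simp only [Pi.sub_apply, Pi.inf_apply, hx', hz hiP] at h1
      exact hi (by omega)
    have hwP' : Function.support w' ⊆ P := by
      intro i hi
      by_contra hiP
      have h1 := hwy i
      simp only [Pi.sub_apply, Pi.inf_apply, hy', hz hiP] at h1
      exact hi (by omega)
    obtain ⟨i, hi⟩ := h.support_nonempty hw
    have h1 := hwx i
    have h2 := hwy i
    rw [hP w' hw' hwP', ← hP w hw hwP] at h2
    have h3 : w i ≠ 0 := hi
    simp only [Pi.sub_apply, Pi.inf_apply] at h1 h2
    omega
  refine ⟨Fintype.card P, ⟨AddEquiv.symm ?_⟩⟩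
  have hrange : AddMonoidHom.mrange (factHom (a ∘ g)) = AddSubmonoid.closure (a '' P) := by
    rw [mrange_factHom, Set.range_comp, hgP]
  rw [← hrange]
  exact AddEquiv.ofBijective (factHom (a ∘ g)).mrangeRestrict
    ⟨fun x y hxy => hinj (congrArg Subtype.val hxy), AddMonoidHom.mrangeRestrict_surjective _⟩

theorem support_subset_or_disjoint {u v : Fin p → ℕ} (hu : u ∈ factorizations a d)
    (hv : v ∈ factorizations a d) :
    Function.support u ⊆ Function.support v ∨
      Disjoint (Function.support u) (Function.support v) := by
  by_cases huv : u = v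
  · exact Or.inl (huv ▸ le_rfl)
  · exact Or.inr (h.disjoint_support hu hv huv)

theorem exists_isIteratedGluing_supports {S : AddSubmonoid (Fin r → ℕ)} (ha : IsMinGenBy a S)
    (F : Finset (Fin p → ℕ)) (hF : F.Nonempty) (hFd : ∀ u ∈ F, u ∈ factorizations a d) :
    ∃ L : List (AddSubmonoid (Fin r → ℕ)), L.length = F.card ∧
      IsIteratedGluing d (AddSubmonoid.closure (a '' ⋃ u ∈ F, Function.support u)) L ∧
      ∀ T ∈ L, IsFree T := by
  have hfree : ∀ u ∈ factorizations a d,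
      IsFree (AddSubmonoid.closure (a '' Function.support u)) := by
    intro u hu
    refine h.isFree_closure_image (u := u) fun v hv hvu => ?_
    obtain ⟨i, hi⟩ := h.support_nonempty hv
    exact h.eq_of_mem_support hv hu hi (hvu hi)
  induction hF using Finset.Nonempty.cons_induction with
  | singleton u =>
    refine ⟨[_], rfl, IsIteratedGluing.single _, fun T hT => ?_⟩
    rw [List.mem_singleton.1 hT]
    simpa using hfree u (hFd u (by simp))
  | cons u F huF hF ih =>
    obtain ⟨L, hL, hLg, hLf⟩ := ih fun v hv => hFd v (Finset.mem_cons_of_mem hv)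
    have hu := hFd u (Finset.mem_cons_self _ _)
    refine ⟨AddSubmonoid.closure (a '' Function.support u) :: L, ?_, ?_, ?_⟩
    · rw [List.length_cons, hL, Finset.card_cons]
    · refine IsIteratedGluing.glue _ _ _ _ ?_ hLg
      have hun : ⋃ v ∈ Finset.cons u F huF, Function.support v =
          Function.support u ∪ ⋃ v ∈ F, Function.support v := by
        ext i
        simp
      rw [hun]
      refine h.isGluing_image ha ?_ (fun v hv => h.support_subset_or_disjoint hv hu)
        ⟨u, hu, le_rfl⟩ ?_
      · simp only [Set.disjoint_iUnion_right]
        exact fun v hv => h.disjoint_support hu (hFd v (Finset.mem_cons_of_mem hv))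
          fun huv => huF (huv ▸ hv)
      · obtain ⟨v, hv⟩ := hF
        exact ⟨v, hFd v (Finset.mem_cons_of_mem hv),
          Set.subset_biUnion_of_mem (u := fun v : Fin p → ℕ => Function.support v) hv⟩
    · intro T hT
      rcases List.mem_cons.1 hT with rfl | hT
      · exact hfree u hu
      · exact hLf T hT

theorem exists_isIteratedGluing {S : AddSubmonoid (Fin r → ℕ)} (ha : IsMinGenBy a S)
    (hnt : (factorizations a d).Nontrivial) :
    ∃ L : List (AddSubmonoid (Fin r → ℕ)),
      (L.length : ℕ∞) = (factorizations a d).encard ∧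
      IsIteratedGluing d S L ∧ ∀ T ∈ L, IsFree T := by
  classical
  obtain ⟨u, hu, v, hv, huv⟩ := hnt
  let Z := h.finite_factorizations.toFinset
  have hZ : ∀ {w}, w ∈ Z ↔ w ∈ factorizations a d := h.finite_factorizations.mem_toFinset
  have hF : (Z.erase u).Nonempty := ⟨v, Finset.mem_erase.2 ⟨huv.symm, hZ.2 hv⟩⟩
  have hFd : ∀ w ∈ Z.erase u, w ∈ factorizations a d := fun w hw =>
    hZ.1 (Finset.mem_of_mem_erase hw)
  obtain ⟨L, hL, hLg, hLf⟩ := h.exists_isIteratedGluing_supports ha _ hF hFd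
  set Q : Set (Fin p) := ⋃ w ∈ Z.erase u, Function.support w with hQ
  have huQ : Disjoint (Function.support u) Q := by
    simp only [hQ, Set.disjoint_iUnion_right]
    exact fun w hw => h.disjoint_support hu (hFd w hw) (Finset.ne_of_mem_erase hw).symm
  have hwQ : ∀ w ∈ factorizations a d, w ≠ u → Function.support w ⊆ Q := fun w hw hwu =>
    Set.subset_biUnion_of_mem (u := fun v : Fin p → ℕ => Function.support v)
      (Finset.mem_erase.2 ⟨hwu, hZ.2 hw⟩)
  -- The block `Qᶜ` holds the support of `u` together with all generators that occur in no
  -- factorization of `d`.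
  refine ⟨AddSubmonoid.closure (a '' Qᶜ) :: L, ?_, ?_, ?_⟩
  · rw [h.finite_factorizations.encard_eq_coe_toFinset_card, List.length_cons, hL,
      Finset.card_erase_add_one (hZ.2 hu)]
  · have hS : S = AddSubmonoid.closure (a '' (Qᶜ ∪ Q)) := by
      rw [Set.compl_union_self, Set.image_univ, ha.isMinGenSet.closure_eq]
    rw [hS]
    refine IsIteratedGluing.glue _ _ _ _ (h.isGluing_image ha disjoint_compl_left ?_ ?_ ?_) hLg
    · intro w hw
      by_cases hwu : w = u
      · exact Or.inl (hwu ▸ huQ.subset_compl_right)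
      · exact Or.inr (disjoint_compl_right.mono_left (hwQ w hw hwu))
    · exact ⟨u, hu, huQ.subset_compl_right⟩
    · exact ⟨v, hv, hwQ v hv huv.symm⟩
  · intro T hT
    rcases List.mem_cons.1 hT with rfl | hT
    · refine h.isFree_closure_image (u := u) fun w hw hwc => ?_
      by_contra hwu
      obtain ⟨i, hi⟩ := h.support_nonempty hw
      exact hwc hi (hwQ w hw hwu hi)
    · exact hLf T hT

/-! ### Cardinality of minimal presentations -/

theorem span_difference_eq_ker :
    Submodule.span ℚ (difference '' σ) = LinearMap.ker (genMatrix a).mulVecLin := by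
  apply le_antisymm
  · rw [Submodule.span_le]
    rintro _ ⟨w, hw, rfl⟩
    exact (difference_mem_ker _).2 (h.isPresentation.factHom_eq hw)
  · intro x hx
    let C : AddCon (Fin p → ℕ) :=
      AddCon.ker ((Submodule.span ℚ (difference '' σ)).mkQ.toAddMonoidHom.comp castHom)
    have hC : ∀ {s t : Fin p → ℕ},
        C s t ↔ difference (s, t) ∈ Submodule.span ℚ (difference '' σ) := by
      intro s t
      refine (AddCon.ker_rel _).trans ?_
      exact Submodule.Quotient.eq _
    -- Clear denominators, then split into positive and negative parts to turn a kernel vector into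
    -- a relation over `ℕ`.
    obtain ⟨N, hN⟩ := IsLocalization.exist_integer_multiples_of_finite (nonZeroDivisors ℤ) x
    choose z hz using hN
    have hN0 : ((N : ℤ) : ℚ) ≠ 0 := by exact_mod_cast nonZeroDivisors.coe_ne_zero N
    have hzx : difference (fun i => (z i).toNat, fun i => (-z i).toNat) = ((N : ℤ) : ℚ) • x := by
      funext i
      have h1 : (((z i).toNat : ℤ) - ((-z i).toNat : ℤ) : ℤ) = z i := by omega
      have h2 : (z i : ℚ) = ((N : ℤ) : ℚ) * x i := by
        have := hz i
        simpa [Algebra.smul_def] using this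
      change (((z i).toNat : ℚ) - ((-z i).toNat : ℚ)) = ((N : ℤ) : ℚ) * x i
      rw [← h2, ← h1]
      push_cast
      simp
    have hmem : ((N : ℤ) : ℚ) • x ∈ Submodule.span ℚ (difference '' σ) := by
      rw [← hzx]
      refine hC.1 (h.isPresentation.rel_of_factHom_eq C
        (fun w hw => hC.2 (Submodule.subset_span ⟨w, hw, rfl⟩)) ?_)
      rw [← difference_mem_ker (a := a)
        (w := (fun i => (z i).toNat, fun i => (-z i).toNat)), hzx]
      exact Submodule.smul_mem _ _ hx
    exact (Submodule.smul_mem_iff _ hN0).1 hmem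

/-- Linear algebra detects the classes of factorizations of `d` under `R`: restriction to the
supports of one class, followed by the matrix, kills all differences from `τ`, but not that of a
pair leaving the class. -/
theorem of_span_difference (hτσ : τ ⊆ σ)
    (hspan : ∀ w ∈ σ, difference w ∈ Submodule.span ℚ (difference '' τ)) :
    IsPresentation a τ := by
  refine h.isPresentation.of_rel (fun w hw => h.isPresentation.factHom_eq (hτσ hw)) fun w hw => ?_
  set R := addConGen (fun u v => (u, v) ∈ τ) with hR
  -- The generators used by the class of `w.1`. By disjointness of supports, no factorization
  -- outside the class meets `I`.
  let I : Set (Fin p) :=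
    ⋃ v ∈ {v | v ∈ factorizations a d ∧ R w.1 v}, Function.support v
  have hin : ∀ v ∈ factorizations a d, R w.1 v → factHom a (I.indicator v) = d := by
    intro v hv hRv
    have hvI : Function.support v ⊆ I := Set.subset_biUnion_of_mem
      (u := fun v : Fin p → ℕ => Function.support v) (Set.mem_ofPred.2 ⟨hv, hRv⟩)
    rw [Set.indicator_eq_self.2 hvI]
    exact hv
  have hout : ∀ v ∈ factorizations a d, ¬ R w.1 v → factHom a (I.indicator v) = 0 := by
    intro v hv hRv
    have : I.indicator v = 0 := by
      refine Set.indicator_eq_zero.2 ?_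
      simp only [I, Set.disjoint_iUnion_right]
      exact fun v' hv' => h.disjoint_support hv hv'.1 fun hvv => hRv (hvv ▸ hv'.2)
    rw [this, map_zero]
  let φ := (genMatrix a).mulVecLin ∘ₗ (Matrix.diagonal (I.indicator (1 : Fin p → ℚ))).mulVecLin
  have hφ : ∀ v : (Fin p → ℕ) × (Fin p → ℕ), φ (difference v) = 0 ↔
      factHom a (I.indicator v.1) = factHom a (I.indicator v.2) := by
    intro v
    rw [← difference_mem_ker (a := a) (w := (I.indicator v.1, I.indicator v.2)),
      LinearMap.mem_ker, LinearMap.comp_apply]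
    congr! 2
    funext i
    by_cases hi : i ∈ I <;> simp [difference, castHom, Matrix.mulVec_diagonal, hi]
  have hle : Submodule.span ℚ (difference '' τ) ≤ LinearMap.ker φ := by
    rw [Submodule.span_le]
    rintro _ ⟨v, hv, rfl⟩
    refine (hφ v).2 ?_
    have hRv : R v.1 v.2 := AddConGen.Rel.of _ _ hv
    have hv1 := h.fst_mem v (hτσ hv)
    have hv2 := h.snd_mem (hτσ hv)
    by_cases hRw : R w.1 v.1
    · rw [hin _ hv1 hRw, hin _ hv2 (R.trans hRw hRv)]
    · rw [hout _ hv1 hRw, hout _ hv2 fun h2 => hRw (R.trans h2 (R.symm hRv))]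
  by_contra hRw
  have hw0 := (hφ w).1 (hle (hspan w hw))
  rw [hin _ (h.fst_mem w hw) (R.refl _), hout _ (h.snd_mem hw) hRw] at hw0
  exact h.degree_ne_zero hw0

/-- Minimality forces a maximal independent subfamily of differences to exhaust `σ`. -/
theorem encard_eq_finrank_ker (hmin : IsMinPresentation a σ) :
    σ.encard = Module.finrank ℚ (LinearMap.ker (genMatrix a).mulVecLin) := by
  obtain ⟨κ, g, hg, hspan, hli⟩ := exists_linearIndependent' ℚ (fun w : σ => difference w.1)
  set τ : Set ((Fin p → ℕ) × (Fin p → ℕ)) := Set.range fun k => (g k : _ × _) with hτ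
  have hspan' : Submodule.span ℚ (difference '' τ) = Submodule.span ℚ (difference '' σ) := by
    rw [hτ, ← Set.range_comp, Set.image_eq_range]
    exact hspan
  have hτσ : τ ⊆ σ := by
    rintro _ ⟨k, rfl⟩
    exact (g k).2
  have hτp : IsPresentation a τ := h.of_span_difference hτσ fun w hw => by
    rw [hspan']
    exact Submodule.subset_span ⟨w, hw, rfl⟩
  have hτeq : τ = σ := by
    by_contra hne
    exact hmin.2 τ (hτσ.ssubset_of_ne hne) hτp
  have : Finite κ := hli.finite
  have : Fintype κ := Fintype.ofFinite κ
  have hcard := finrank_span_eq_card hli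
  rw [hspan, ← Set.image_eq_range, h.span_difference_eq_ker] at hcard
  have hinj : Function.Injective fun k => (g k : (Fin p → ℕ) × (Fin p → ℕ)) :=
    Subtype.val_injective.comp hg
  rw [hcard, ← hτeq, hτ, ← Set.image_univ, hinj.injOn.encard_image, Set.encard_univ,
    ENat.card_eq_coe_fintype_card]

end IsPresentationAt

end AffineSemigroup

theorem mainTheorem3 {r p : ℕ} (a : Fin p → Fin r → ℕ) (S : AddSubmonoid (Fin r → ℕ))
    (ha : AffineSemigroup.IsMinGenBy a S) (d : Fin r → ℕ) (hdS : d ∈ S) (hd : d ≠ 0)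
    (hB : AffineSemigroup.betti a = {d}) :
    AffineSemigroup.IsPresentation a (AffineSemigroup.circuits a) ∧
    (∃ L : List (AddSubmonoid (Fin r → ℕ)),
      (L.length : ℕ∞) = (AffineSemigroup.factorizations a d).encard ∧
      AffineSemigroup.IsIteratedGluing d S L ∧
      ∀ T ∈ L, AffineSemigroup.IsFree T) ∧
    AffineSemigroup.IsCompleteIntersection a := by
  -- Needed for all minimal presentations, since `IsNu` constrains the cardinality of each.
  have hmin : ∀ σ, AffineSemigroup.IsMinPresentation a σ →
      AffineSemigroup.IsPresentationAt a d σ := fun σ hσ =>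
    { isPresentation := hσ.1
      fst_mem := fun w hw => by
        have : AffineSemigroup.factHom a w.1 ∈ AffineSemigroup.betti a := ⟨σ, hσ, w, hw, rfl⟩
        rwa [hB] at this
      generator_ne_zero := ha.ne_zero
      degree_ne_zero := hd }
  obtain ⟨σ, hσ, w, hw, -⟩ : d ∈ AffineSemigroup.betti a := hB ▸ rfl
  have h := hmin σ hσ
  refine ⟨h.isPresentation_circuits, h.exists_isIteratedGluing ha
    ⟨w.1, h.fst_mem w hw, w.2, h.snd_mem hw, hσ.fst_ne_snd hw⟩,
    _, ⟨⟨σ, hσ⟩, fun σ' hσ' => (hmin σ' hσ').encard_eq_finrank_ker hσ'⟩, ?_⟩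
  have := (AffineSemigroup.genMatrix a).mulVecLin.finrank_range_add_finrank_ker
  rw [Module.finrank_fin_fun] at this
  rw [add_comm]
  exact this
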